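/- Let $\mathbb K$ be $\mathbb R$ or $\mathbb C$, let $w$ be the space of all sequences $x=(x_k)_{k\ge 0}$ in $\mathbb K$, and put $\mathbb N=\{1,2,\dots\}$. Let $p=(p_k)_{k\ge0}$ and $q=(q_k)_{k\ge0}$ be bounded sequences of strictly positive real numbers, and put $$c_0(q)=\{x\in w:\lim_k|x_k|^{q_k}=0\},\quad c(q)=\{x\in w:\exists\, l\in\mathbb K,\ \lim_k|x_k-l|^{q_k}=0\},\quad l_\infty(q)=\{x\in w:\sup_k|x_k|^{q_k}<\infty\}.$$ Let $r,s,t\in w$ with $r_n\ne0$ and $t_n\neq 0$ for all $n$ and $s_0\ne0$, and let $$c_0(r,s,t,p;\Delta)=\Big\{x\in w:\Big(\frac1{r_n}\sum_{k=0}^n s_{n-k}t_k(x_k-x_{k-1})\Big)_n\in c_0(p)\Big\},\qquad x_{-1}=0 .$$ Its $\beta$-dual $[c_0(r,s,t,p;\Delta)]^\beta$ is the set of all $a\in w$ such that $\sum_k a_kx_k$ converges for every $x\in c_0(r,s,t,p;\Delta)$. For sets $U,V\subseteq w$, $(U,V)$ is the class of infinite matrices $A=(a_{nk})_{n,k\ge0}$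 over $\mathbb K$ such that for every $x\in U$ all the series $(Ax)_n=\sum_{k=0}^\infty a_{nk}x_k$ converge and $Ax\in V$. Put $D^{(s)}_0=1/s_0$ and, for $n\ge1$, $D^{(s)}_n=s_0^{-(n+1)}\det(s_{i-j+1})_{1\le i,j\le n}$, where $s_m=0$ for $m<0$. For an infinite matrix $A=(a_{nk})$ over $\mathbb K$ put $$\tilde e_{nk}=\lim_{m\to\infty} r_k\bigg[\frac{a_{nk}}{s_0t_k}+\Big(\frac{D^{(s)}_0}{t_k}-\frac{D^{(s)}_1}{t_{k+1}}\Big)\sum_{j=k+1}^m a_{nj}+\sum_{l=k+2}^m(-1)^{l-k}\frac{D^{(s)}_{l-k}}{t_l}\sum_{j=l}^m a_{nj}\bigg];$$ this limit exists for all $k$ whenever $(a_{nk})_k\in[c_0(r,s,t,p;\Delta)]^\beta$. Then: (a) $A\in(c_0(r,s,t,p;\Delta),c_0(q))$ if and only if $(a_{nk})_k\in[c_0(r,s,t,p;\Delta)]^\beta$ for every $n$ and $$\lim_n|\tilde e_{nk}|^{q_n}=0\ \text{ for all }k,\qquad \forall L\in\mathbb N\ \exists N\in\mathbb N:\ \sup_n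 L^{1/q_n}\sum_k|\tilde e_{nk}|N^{-1/p_k}<\infty .$$ (b) $A\in(c_0(r,s,t,p;\Delta),c(q))$ if and only if $(a_{nk})_k\in[c_0(r,s,t,p;\Delta)]^\beta$ for every $n$ and $$\exists(\alpha_k)\in w:\ \lim_n|\tilde e_{nk}-\alpha_k|^{q_n}=0\ \text{ for all }k,\qquad \exists N\in\mathbb N:\ \sup_n\sum_k|\tilde e_{nk}|N^{-1/p_k}<\infty,$$ $$\exists(\alpha_k)\in w\ \forall L\in\mathbb N\ \exists N\in\mathbb N:\ \sup_n L^{1/q_n}\sum_k|\tilde e_{nk}-\alpha_k|N^{-1/p_k}<\infty .$$ (c) $A\in(c_0(r,s,t,p;\Delta),l_\infty(q))$ if and only if $(a_{nk})_k\in[c_0(r,s,t,p;\Delta)]^\beta$ for every $n$ and $$\exists N\in\mathbb N:\ \sup_n\Big(\sum_k|\tilde e_{nk}|N^{-1/p_k}\Big)^{q_n}<\infty .$$ -/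

import Mathlib

open Filter Topology
open scoped ENNReal

noncomputable section

namespace GeneralizedMeans

variable {𝕜 : Type*} [RCLike 𝕜]

/-- Maddox's space `c₀(p)`. -/
def maddoxC0 (𝕜 : Type*) [RCLike 𝕜] (p : ℕ → ℝ) : Set (ℕ → 𝕜) :=
  {x | Tendsto (fun k => ‖x k‖ ^ p k) atTop (𝓝 0)}

/-- Maddox's space `c(p)`. -/
def maddoxC (𝕜 : Type*) [RCLike 𝕜] (p : ℕ → ℝ) : Set (ℕ → 𝕜) :=
  {x | ∃ l : 𝕜, Tendsto (fun k => ‖x k - l‖ ^ p k) atTop (𝓝 0)}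

/-- Maddox's space `l_∞(p)`. -/
def maddoxLinf (𝕜 : Type*) [RCLike 𝕜] (p : ℕ → ℝ) : Set (ℕ → 𝕜) :=
  {x | BddAbove (Set.range fun k => ‖x k‖ ^ p k)}

/-- The space `cs` of (conditionally) convergent series. -/
def convSeries (𝕜 : Type*) [RCLike 𝕜] : Set (ℕ → 𝕜) :=
  {x | ∃ l : 𝕜, Tendsto (fun m => ∑ k ∈ Finset.range m, x k) atTop (𝓝 l)}

/-- The multiplier space `M(U, V)`. -/
def multiplier (U V : Set (ℕ → 𝕜)) : Set (ℕ → 𝕜) :=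
  {a | ∀ u ∈ U, (fun k => a k * u k) ∈ V}

/-- The β-dual `U^β = M(U, cs)`. -/
def betaDual (U : Set (ℕ → 𝕜)) : Set (ℕ → 𝕜) := multiplier U (convSeries 𝕜)

/-- `A x` exists and equals `z`: every series `∑ₖ a_{nk} xₖ` converges, with sum `zₙ`. -/
def IsTransform (A : ℕ → ℕ → 𝕜) (x z : ℕ → 𝕜) : Prop :=
  ∀ n, Tendsto (fun m => ∑ k ∈ Finset.range m, A n k * x k) atTop (𝓝 (z n))

/-- The class `(U, V)` of infinite matrices that map `U` into `V`. -/
def matrixClass (U V : Set (ℕ → 𝕜)) : Set (ℕ → ℕ → 𝕜) :=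
  {A | ∀ x ∈ U, ∃ z ∈ V, IsTransform A x z}

/-- The difference operator, with the convention `x₋₁ = 0`. -/
def diff (x : ℕ → 𝕜) : ℕ → 𝕜
  | 0 => x 0
  | k + 1 => x (k + 1) - x k

/-- The generalized means `(1 / rₙ) ∑_{k ≤ n} s_{n-k} tₖ xₖ` of `x`. -/
def genMean (r s t x : ℕ → 𝕜) (n : ℕ) : 𝕜 :=
  1 / r n * ∑ k ∈ Finset.range (n + 1), s (n - k) * t k * x k

/-- The space `X(r, s, t; Δ)`; for `X = c₀(p)` this is `c₀(r, s, t, p; Δ)`. -/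
def meanDiffSpace (r s t : ℕ → 𝕜) (X : Set (ℕ → 𝕜)) : Set (ℕ → 𝕜) :=
  {x | genMean r s t (diff x) ∈ X}

/-- `Dₙ^{(s)}`: the `n × n` determinant with entry `s_{i-j+1}` in row `i`, column `j`
(zero for `j > i + 1`), divided by `s₀^{n+1}`; for `n = 0` it is `1 / s₀`. -/
def Dcoef (s : ℕ → 𝕜) (n : ℕ) : 𝕜 :=
  1 / s 0 ^ (n + 1) *
    (Matrix.of fun i j : Fin n =>
      if (j : ℕ) ≤ (i : ℕ) + 1 then s ((i : ℕ) + 1 - (j : ℕ)) else 0).det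

/-- The triangle `E = (e_{mk})` attached to a sequence `a`. -/
def Emat (r s t a : ℕ → 𝕜) (m k : ℕ) : 𝕜 :=
  if k ≤ m then
    r k * (a k / (s 0 * t k)
      + (Dcoef s 0 / t k - Dcoef s 1 / t (k + 1)) * ∑ j ∈ Finset.Icc (k + 1) m, a j
      + ∑ l ∈ Finset.Icc (k + 2) m,
          (-1) ^ (l - k) * (Dcoef s (l - k) / t l) * ∑ j ∈ Finset.Icc l m, a j)
  else 0

/-- The matrix `Ẽ = (ẽ_{nk})` of `A`: `ẽ_{nk}` is the limit, as `m → ∞`, of the entries `e_{mk}`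
of the triangle `E` attached to the `n`-th row of `A`. The limit exists if that row lies in the
β-dual of `c₀(r, s, t, p; Δ)`; `limUnder` has an arbitrary value if it does not exist. -/
def Etilde (r s t : ℕ → 𝕜) (A : ℕ → ℕ → 𝕜) (n k : ℕ) : 𝕜 :=
  limUnder atTop fun m => Emat r s t (A n) m k

/-- `limₙ |a_{nk}|^{qₙ} = 0` for all `k`. -/
def CondColNull (q : ℕ → ℝ) (A : ℕ → ℕ → 𝕜) : Prop :=
  ∀ k, Tendsto (fun n => ‖A n k‖ ^ q n) atTop (𝓝 0)

/-- `∀ L ∃ N: supₙ L^{1/qₙ} ∑ₖ |a_{nk}| N^{-1/pₖ} < ∞`. -/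
def CondRowNull (p q : ℕ → ℝ) (A : ℕ → ℕ → 𝕜) : Prop :=
  ∀ L : ℕ, 1 ≤ L → ∃ N : ℕ, 1 ≤ N ∧
    (⨆ n, (L : ℝ≥0∞) ^ (1 / q n) * ∑' k, ‖A n k‖ₑ * (N : ℝ≥0∞) ^ (-(1 / p k))) < ⊤

/-- `∃ (αₖ): limₙ |a_{nk} - αₖ|^{qₙ} = 0` for all `k`. -/
def CondColConv (q : ℕ → ℝ) (A : ℕ → ℕ → 𝕜) : Prop :=
  ∃ α : ℕ → 𝕜, CondColNull q fun n k => A n k - α k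

/-- `∃ N: supₙ ∑ₖ |a_{nk}| N^{-1/pₖ} < ∞`. -/
def CondRowBdd (p : ℕ → ℝ) (A : ℕ → ℕ → 𝕜) : Prop :=
  ∃ N : ℕ, 1 ≤ N ∧ (⨆ n, ∑' k, ‖A n k‖ₑ * (N : ℝ≥0∞) ^ (-(1 / p k))) < ⊤

/-- `∃ (αₖ) ∀ L ∃ N: supₙ L^{1/qₙ} ∑ₖ |a_{nk} - αₖ| N^{-1/pₖ} < ∞`. -/
def CondRowConv (p q : ℕ → ℝ) (A : ℕ → ℕ → 𝕜) : Prop :=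
  ∃ α : ℕ → 𝕜, CondRowNull p q fun n k => A n k - α k

/-- `∃ N: supₙ (∑ₖ |a_{nk}| N^{-1/pₖ})^{qₙ} < ∞`. -/
def CondRowPowBdd (p q : ℕ → ℝ) (A : ℕ → ℕ → 𝕜) : Prop :=
  ∃ N : ℕ, 1 ≤ N ∧ (⨆ n, (∑' k, ‖A n k‖ₑ * (N : ℝ≥0∞) ^ (-(1 / p k))) ^ q n) < ⊤

end GeneralizedMeans

end

open GeneralizedMeans

/-!
The power series `∑ sₙ Xⁿ` has the inverse `∑ (-1)ⁿ Dₙ Xⁿ`, so every `x` is recovered from the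
generalized means `y` of its differences, and summation by parts turns the partial sums of
`∑ aₖ xₖ` into `∑ₖ e_{mk} yₖ`. Thus `A` maps `X(r, s, t; Δ)` to `V` if and only if its rows lie in
the `β`-dual and `Ẽ` maps `X` to `V`.

For bounded `p` the space `X = c₀(p)` is the intersection of the weighted spaces `c₀` with the
weights `N ^ (-1 / pₖ)`. As a projective limit it is a Baire space, so a pointwise bound on the
functionals given by the rows of a matrix is uniform on a neighbourhood of zero, which means that
the rows are bounded in the norm of a single weighted `ℓ¹`. Such a bound and the limits of the
columns determine the limits of the transforms. In (b), if the row condition holds for a sequence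
other than the column limits, then the constants are `O` of every weight of the target space, and
the row condition for the column limits follows from mere boundedness.
-/

namespace GeneralizedMeans

/-! ### Inverting the generalized means -/

section Inversion

open Finset PowerSeries

/-- The leading `n × n` section of the lower triangular Toeplitz matrix `(s_{i-j})`, which
represents multiplication by the power series `∑ sₙ Xⁿ`. -/
def lowerToeplitz {R : Type*} [Zero R] (s : ℕ → R) (n : ℕ) : Matrix (Fin n) (Fin n) R :=
  Matrix.of fun i j => if j ≤ i then s (i - j : ℕ) else 0

theorem det_lowerToeplitz {R : Type*} [CommRing R] (s : ℕ → R) (n : ℕ) :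
    (lowerToeplitz s n).det = s 0 ^ n := by
  have h : (lowerToeplitz s n).IsLowerTriangular := fun i j (hij : i < j) => if_neg hij.not_ge
  rw [Matrix.det_of_isLowerTriangular _ h]
  simp [lowerToeplitz]

theorem coeff_mk_mul {R : Type*} [Semiring R] (f : ℕ → R) (φ : R⟦X⟧) (n : ℕ) :
    coeff n (mk f * φ) = ∑ k ∈ range (n + 1), f k * coeff (n - k) φ := by
  simp only [coeff_mul, coeff_mk, Nat.sum_antidiagonal_eq_sum_range_succ_mk]

theorem lowerToeplitz_mulVec_coeff {R : Type*} [CommRing R] (s : ℕ → R) (n : ℕ) (φ : R⟦X⟧)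
    (i : Fin n) :
    (lowerToeplitz s n).mulVec (fun j => coeff j φ) i = coeff i (mk s * φ) := by
  have hsub : {j ∈ range n | j ≤ (i : ℕ)} = range (i + 1) := by
    ext j
    simp only [mem_filter, mem_range]
    omega
  calc (lowerToeplitz s n).mulVec (fun j => coeff j φ) i
      = ∑ j ∈ range n, if j ≤ (i : ℕ) then s (i - j) * coeff j φ else 0 := by
        rw [sum_range]
        simp [lowerToeplitz, Matrix.mulVec, dotProduct, ite_mul]
    _ = ∑ j ∈ range (i + 1), s (i - j) * coeff j φ := by rw [← sum_filter, hsub]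
    _ = coeff i (mk s * φ) := by
        rw [mul_comm (mk s), coeff_mul, Nat.sum_antidiagonal_eq_sum_range_succ_mk]
        simp only [coeff_mk, mul_comm]

variable {𝕜 : Type*} [RCLike 𝕜]

/-- By Cramer's rule for the Toeplitz system `T c = e₀` solved by the coefficients `c` of the
inverse series; the cofactor that gives `cₙ` is the determinant in `Dcoef s n`. -/
theorem coeff_inv_mk {s : ℕ → 𝕜} (hs : s 0 ≠ 0) (n : ℕ) :
    coeff n (mk s)⁻¹ = (-1) ^ n * Dcoef s n := by
  have hsystem : (lowerToeplitz s (n + 1)).mulVec (fun j => coeff j (mk s)⁻¹) = Pi.single 0 1 := by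
    ext i
    rw [lowerToeplitz_mulVec_coeff, PowerSeries.mul_inv_cancel _ (by simpa using hs), coeff_one,
      Pi.single_apply]
    simp only [Fin.ext_iff, Fin.val_zero]
  have hcofactor : (lowerToeplitz s (n + 1)).submatrix (Fin.succAbove 0)
      (Fin.succAbove (Fin.last n)) = Matrix.of fun i j : Fin n =>
        if (j : ℕ) ≤ (i : ℕ) + 1 then s ((i : ℕ) + 1 - (j : ℕ)) else 0 := by
    ext i j
    simp only [lowerToeplitz, Matrix.submatrix_apply, Matrix.of_apply, Fin.zero_succAbove,
      Fin.succAbove_last, Fin.le_def, Fin.val_succ, Fin.val_castSucc]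
  have hcramer := congrArg (fun v => (lowerToeplitz s (n + 1)).adjugate.mulVec v (Fin.last n))
    hsystem
  simp only [Matrix.mulVec_mulVec, Matrix.adjugate_mul, Matrix.smul_mulVec, Matrix.one_mulVec,
    Matrix.mulVec_single_one, Matrix.col_apply, Pi.smul_apply, smul_eq_mul, det_lowerToeplitz,
    Fin.val_last, Matrix.adjugate_fin_succ_eq_det_submatrix, hcofactor, Fin.val_zero,
    zero_add] at hcramer
  rw [Dcoef, ← mul_right_inj' (pow_ne_zero (n + 1) hs), hcramer]
  field_simp

theorem sum_range_succ_diff (x : ℕ → 𝕜) (n : ℕ) : ∑ k ∈ range (n + 1), diff x k = x n := by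
  induction n with
  | zero => simp [diff]
  | succ n ih => rw [sum_range_succ, ih, diff, add_sub_cancel]

theorem diff_sum_range_succ (d : ℕ → 𝕜) : diff (fun n => ∑ k ∈ range (n + 1), d k) = d := by
  ext (_ | n)
  · simp [diff]
  · rw [diff, sum_range_succ _ (n + 1), add_sub_cancel_left]

theorem genMean_eq_iff_mk_mul_mk {r : ℕ → 𝕜} (hr : ∀ n, r n ≠ 0) {s t d y : ℕ → 𝕜} :
    genMean r s t d = y ↔ mk (fun k => t k * d k) * mk s = mk fun k => r k * y k := by
  simp only [funext_iff, PowerSeries.ext_iff, genMean, one_div_mul_eq_div, div_eq_iff (hr _),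
    coeff_mk_mul, coeff_mk, mul_comm (r _)]
  refine forall_congr' fun n => Eq.congr_left (sum_congr rfl fun k _ => ?_)
  ring

theorem genMean_eq_iff {r s t : ℕ → 𝕜} (hr : ∀ n, r n ≠ 0) (hs : s 0 ≠ 0) (ht : ∀ n, t n ≠ 0)
    {d y : ℕ → 𝕜} :
    genMean r s t d = y ↔ ∀ n, d n =
      ∑ k ∈ range (n + 1), (-1) ^ (n - k) * (Dcoef s (n - k) / t n) * (r k * y k) := by
  rw [genMean_eq_iff_mk_mul_mk hr, ← PowerSeries.eq_mul_inv_iff_mul_eq (by simpa using hs),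
    PowerSeries.ext_iff]
  simp only [coeff_mk_mul, coeff_inv_mk hs, coeff_mk]
  refine forall_congr' fun n => ?_
  rw [mul_comm (t n), ← eq_div_iff (ht n), sum_div]
  refine Eq.congr_right (sum_congr rfl fun k _ => ?_)
  ring

theorem exists_genMean_diff_eq {r s t : ℕ → 𝕜} (hr : ∀ n, r n ≠ 0) (hs : s 0 ≠ 0)
    (ht : ∀ n, t n ≠ 0) (y : ℕ → 𝕜) : ∃ x, genMean r s t (diff x) = y :=
  ⟨fun j => ∑ l ∈ range (j + 1), ∑ k ∈ range (l + 1),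
      (-1) ^ (l - k) * (Dcoef s (l - k) / t l) * (r k * y k), by
    rw [diff_sum_range_succ, genMean_eq_iff hr hs ht]
    exact fun _ => rfl⟩

theorem Emat_eq_zero {r s t a : ℕ → 𝕜} {m k : ℕ} (h : m < k) : Emat r s t a m k = 0 :=
  if_neg h.not_ge

theorem Emat_eq_sum_Icc (r s t a : ℕ → 𝕜) {m k : ℕ} (h : k ≤ m) :
    Emat r s t a m k = r k * ∑ l ∈ Icc k m,
      (-1) ^ (l - k) * (Dcoef s (l - k) / t l) * ∑ j ∈ Icc l m, a j := by
  have hpeel {i : ℕ} (hi : i ≤ m) (f : ℕ → 𝕜) :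
      ∑ j ∈ Icc i m, f j = f i + ∑ j ∈ Icc (i + 1) m, f j := by
    rw [← add_sum_Ioc_eq_sum_Icc hi, Icc_add_one_left_eq_Ioc]
  have hD : a k / (s 0 * t k) = Dcoef s 0 / t k * a k := by
    simp only [Dcoef, zero_add, pow_one, Matrix.det_isEmpty, mul_one]
    ring
  rw [Emat, if_pos h, hpeel h, hpeel h a, hD]
  rcases h.eq_or_lt with rfl | h'
  · simp
  · rw [hpeel (i := k + 1) h' fun l =>
      (-1) ^ (l - k) * (Dcoef s (l - k) / t l) * ∑ j ∈ Icc l m, a j]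
    simp only [Nat.sub_self, Nat.add_sub_cancel_left, pow_zero, pow_one]
    ring

theorem sum_range_mul_eq_sum_diff_mul (a x : ℕ → 𝕜) (m : ℕ) :
    ∑ k ∈ range (m + 1), a k * x k = ∑ l ∈ range (m + 1), diff x l * ∑ j ∈ Icc l m, a j := by
  simp_rw [← sum_range_succ_diff x, mul_sum]
  rw [sum_comm' (t' := range (m + 1)) (s' := fun l => Icc l m)]
  · simp only [mul_comm]
  · intro j l
    simp only [mem_range, mem_Icc]
    omega

theorem sum_range_mul_eq_sum_Emat_mul {r s t : ℕ → 𝕜} (hr : ∀ n, r n ≠ 0) (hs : s 0 ≠ 0)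
    (ht : ∀ n, t n ≠ 0) (a x : ℕ → 𝕜) (m : ℕ) :
    ∑ k ∈ range (m + 1), a k * x k =
      ∑ k ∈ range (m + 1), Emat r s t a m k * genMean r s t (diff x) k := by
  have hdiff := (genMean_eq_iff hr hs ht (d := diff x)).1 rfl
  rw [sum_range_mul_eq_sum_diff_mul]
  simp_rw [hdiff, sum_mul]
  rw [sum_comm' (t' := range (m + 1)) (s' := fun k => Icc k m)]
  · refine sum_congr rfl fun k hk => ?_
    rw [Emat_eq_sum_Icc r s t a (mem_range_succ_iff.1 hk), mul_sum, sum_mul]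
    refine sum_congr rfl fun l _ => ?_
    ring
  · intro l k
    simp only [mem_range, mem_Icc]
    omega

theorem sum_range_mul_eq_tsum_Emat_mul {r s t : ℕ → 𝕜} (hr : ∀ n, r n ≠ 0) (hs : s 0 ≠ 0)
    (ht : ∀ n, t n ≠ 0) (a x : ℕ → 𝕜) (m : ℕ) :
    ∑ k ∈ range (m + 1), a k * x k = ∑' k, Emat r s t a m k * genMean r s t (diff x) k := by
  rw [sum_range_mul_eq_sum_Emat_mul hr hs ht, tsum_eq_sum fun k hk => ?_]
  rw [Emat_eq_zero (by simpa using hk), zero_mul]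

end Inversion

variable {𝕜 : Type*} [RCLike 𝕜]

open Asymptotics
open scoped NNReal ZeroAtInfty

/-! ### Rows with a weighted absolute sum -/

theorem isLittleO_iff_forall_enorm_le {α E F : Type*} [SeminormedAddGroup E]
    [SeminormedAddGroup F] {l : Filter α} {f : α → E} {g : α → F} :
    f =o[l] g ↔ ∀ ε : ℝ≥0, 0 < ε → ∀ᶠ x in l, ‖f x‖ₑ ≤ ε * ‖g x‖ₑ := by
  simp only [isLittleO_iff, NNReal.forall, enorm_eq_nnnorm, ← ENNReal.coe_mul,
    ENNReal.coe_le_coe, ← NNReal.coe_le_coe, NNReal.coe_mul, coe_nnnorm, NNReal.coe_mk]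
  exact ⟨fun h ε _ hε => h hε, fun h ε hε => h ε hε.le hε⟩

theorem exists_forall_enorm_le_of_isBigO {E F : Type*} [NormedAddCommGroup E]
    [NormedAddCommGroup F] {f : ℕ → E} {g : ℕ → F} (hg : ∀ n, g n ≠ 0) (h : f =O[atTop] g) :
    ∃ M : ℕ, ∀ n, ‖f n‖ₑ ≤ M * ‖g n‖ₑ := by
  obtain ⟨C, hC⟩ := (isBigO_nat_atTop_iff fun n hn => absurd hn (hg n)).1 h
  obtain ⟨M, hM⟩ := exists_nat_ge C
  refine ⟨M, fun n => ?_⟩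
  have hn : ‖f n‖₊ ≤ M * ‖g n‖₊ :=
    (hC n).trans (mul_le_mul_of_nonneg_right hM (norm_nonneg _))
  simpa only [enorm_eq_nnnorm, ENNReal.coe_mul, ENNReal.coe_natCast] using
    ENNReal.coe_le_coe.2 hn

/-- The `ℓ¹`-norm of the matrix row `b` with respect to the weight `v`. -/
noncomputable def rowNorm (v : ℕ → ℝ) (b : ℕ → 𝕜) : ℝ≥0∞ :=
  ∑' k, ‖b k‖ₑ * ‖v k‖ₑ

theorem rowNorm_sub_le (v : ℕ → ℝ) (b c : ℕ → 𝕜) :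
    rowNorm v (fun k => b k - c k) ≤ rowNorm v b + rowNorm v c := by
  simp_rw [rowNorm, ← ENNReal.tsum_add, ← add_mul]
  gcongr
  exact enorm_sub_le

theorem rowNorm_ne_top_of_eq_zero {v : ℕ → ℝ} {b : ℕ → 𝕜} {K : ℕ} (h : ∀ k, K < k → b k = 0) :
    rowNorm v b ≠ ⊤ := by
  rw [rowNorm, tsum_eq_sum (s := Finset.range (K + 1)) fun k hk => by
    simp [h k (by simpa using hk)]]
  exact ENNReal.sum_ne_top.2 fun k _ => ENNReal.mul_ne_top enorm_ne_top enorm_ne_top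

theorem rowNorm_le_of_tendsto {ι : Type*} {l : Filter ι} [l.NeBot] {v : ℕ → ℝ}
    {b : ι → ℕ → 𝕜} {α : ℕ → 𝕜} {C : ℝ≥0∞} (hα : ∀ k, Tendsto (fun n => b n k) l (𝓝 (α k)))
    (hb : ∀ n, rowNorm v (b n) ≤ C) : rowNorm v α ≤ C := by
  refine ENNReal.tsum_le_of_sum_range_le fun K => le_of_tendsto' (tendsto_finsetSum _ fun k _ =>
    ENNReal.Tendsto.mul_const (hα k).enorm (.inr enorm_ne_top)) fun n => ?_
  exact (ENNReal.sum_le_tsum _).trans (hb n)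

/-- Test against the phases of `b`, cut off at a finite index. -/
theorem rowNorm_le_of_forall_enorm_tsum_le {v : ℕ → ℝ} {b : ℕ → 𝕜} {C : ℝ≥0∞}
    (h : ∀ u : ℕ → 𝕜, u.support.Finite → (∀ k, ‖u k‖ ≤ ‖v k‖) → ‖∑' k, b k * u k‖ₑ ≤ C) :
    rowNorm v b ≤ C := by
  refine ENNReal.tsum_le_of_sum_range_le fun K => ?_
  choose w hw hbw using fun k => RCLike.exists_norm_eq_mul_self (b k)
  let u : ℕ → 𝕜 := fun k => if k < K then ‖v k‖ * w k else 0
  have hu (k : ℕ) (hk : k ∉ Finset.range K) : b k * u k = 0 := by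
    simp_all [u]
  have hsum : ∑' k, b k * u k = ((∑ k ∈ Finset.range K, ‖b k‖ * ‖v k‖ : ℝ) : 𝕜) := by
    rw [tsum_eq_sum hu, RCLike.ofReal_sum]
    refine Finset.sum_congr rfl fun k hk => ?_
    rw [RCLike.ofReal_mul, hbw]
    simp only [u, if_pos (Finset.mem_range.1 hk)]
    ring
  have hfin : u.support.Finite := (Finset.range K).finite_toSet.subset fun k hk => by
    by_contra hk'
    exact hk (if_neg (by simpa using hk'))
  have hle (k : ℕ) : ‖u k‖ ≤ ‖v k‖ := by
    by_cases hk : k < K <;> simp [u, hk, hw]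
  calc ∑ k ∈ Finset.range K, ‖b k‖ₑ * ‖v k‖ₑ
      = ‖∑' k, b k * u k‖ₑ := by
        rw [hsum, ← ofReal_norm, RCLike.norm_ofReal, abs_of_nonneg (by positivity),
          ENNReal.ofReal_sum_of_nonneg fun _ _ => by positivity]
        simp only [ENNReal.ofReal_mul (norm_nonneg _), ofReal_norm]
    _ ≤ C := h u hfin hle

theorem enorm_tsum_mul_le {v : ℕ → ℝ} {b y : ℕ → 𝕜} {ε : ℝ≥0∞}
    (hy : ∀ k, ‖y k‖ₑ ≤ ε * ‖v k‖ₑ) : ‖∑' k, b k * y k‖ₑ ≤ ε * rowNorm v b :=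
  calc ‖∑' k, b k * y k‖ₑ ≤ ∑' k, ‖b k * y k‖ₑ := enorm_tsum_le_tsum_enorm
    _ ≤ ∑' k, ε * (‖b k‖ₑ * ‖v k‖ₑ) := by
      gcongr with k
      rw [enorm_mul, mul_left_comm]
      gcongr
      exact hy k
    _ = ε * rowNorm v b := ENNReal.tsum_mul_left

theorem summable_mul_of_isBigO {v : ℕ → ℝ} {b y : ℕ → 𝕜} (hb : rowNorm v b ≠ ⊤)
    (hy : y =O[atTop] v) : Summable fun k => b k * y k := by
  have hbv : Summable fun k => b k * (v k : 𝕜) := by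
    refine .of_enorm (ne_of_eq_of_ne ?_ hb)
    simp only [rowNorm, ← ofReal_norm, norm_mul, RCLike.norm_ofReal, Real.norm_eq_abs,
      ENNReal.ofReal_mul (norm_nonneg _)]
  refine summable_of_isBigO_nat hbv.norm ((isBigO_refl b _).mul ?_).norm_right
  exact hy.trans (isBigO_of_le _ fun k => by simp)

theorem enorm_tsum_nat_add_mul_le {v : ℕ → ℝ} {b y : ℕ → 𝕜} {ε : ℝ≥0∞} {K : ℕ}
    (hy : ∀ k, K ≤ k → ‖y k‖ₑ ≤ ε * ‖v k‖ₑ) :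
    ‖∑' k, b (k + K) * y (k + K)‖ₑ ≤ ε * rowNorm v b := by
  refine (enorm_tsum_mul_le (v := fun k => v (k + K)) fun k => hy _ (Nat.le_add_left K k)).trans ?_
  gcongr
  exact ENNReal.tsum_comp_le_tsum_of_injective (add_left_injective K) _

theorem isLittleO_tsum_mul {ι : Type*} {l : Filter ι} {v : ℕ → ℝ} {y : ℕ → 𝕜}
    {b : ι → ℕ → 𝕜} {μ : ι → ℝ} {C : ℝ≥0} (hcol : ∀ k, (fun n => b n k) =o[l] μ)
    (hrow : ∀ n, rowNorm v (b n) ≤ C * ‖μ n‖ₑ) (hy : y =o[atTop] v) :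
    (fun n => ∑' k, b n k * y k) =o[l] μ := by
  rw [isLittleO_iff_forall_enorm_le]
  intro ε hε
  obtain ⟨δ, hδ, hδC⟩ : ∃ δ : ℝ≥0, 0 < δ ∧ δ * C ≤ ε / 2 :=
    ⟨ε / 2 / (C + 1), by positivity, by
      rw [div_mul_eq_mul_div]
      exact div_le_of_le_mul₀ (by positivity) (by positivity) (by gcongr; simp)⟩
  obtain ⟨K, hK⟩ := eventually_atTop.1 (isLittleO_iff_forall_enorm_le.1 hy δ hδ)
  have hhead : (fun n => ∑ k ∈ Finset.range K, b n k * y k) =o[l] μ :=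
    .fun_sum fun k _ => by simpa only [mul_comm] using (hcol k).const_mul_left (y k)
  filter_upwards [isLittleO_iff_forall_enorm_le.1 hhead (ε / 2) (half_pos hε)] with n hn
  have hsummable : Summable fun k => b n k * y k := summable_mul_of_isBigO
    ((hrow n).trans_lt (ENNReal.mul_lt_top ENNReal.coe_lt_top enorm_lt_top)).ne hy.isBigO
  have htail : ‖∑' k, b n (k + K) * y (k + K)‖ₑ ≤ (ε / 2 : ℝ≥0) * ‖μ n‖ₑ :=
    calc ‖∑' k, b n (k + K) * y (k + K)‖ₑ ≤ δ * (C * ‖μ n‖ₑ) :=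
          (enorm_tsum_nat_add_mul_le hK).trans (by gcongr; exact hrow n)
      _ ≤ (ε / 2 : ℝ≥0) * ‖μ n‖ₑ := by
        rw [← mul_assoc, ← ENNReal.coe_mul]
        gcongr
  calc ‖∑' k, b n k * y k‖ₑ
      ≤ ‖∑ k ∈ Finset.range K, b n k * y k‖ₑ + ‖∑' k, b n (k + K) * y (k + K)‖ₑ := by
        rw [← hsummable.sum_add_tsum_nat_add K]
        exact enorm_add_le _ _
    _ ≤ (ε / 2 : ℝ≥0) * ‖μ n‖ₑ + (ε / 2 : ℝ≥0) * ‖μ n‖ₑ := add_le_add hn htail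
    _ = ε * ‖μ n‖ₑ := by rw [← add_mul, ← ENNReal.coe_add, add_halves]

theorem tendsto_tsum_mul {ι : Type*} {l : Filter ι} [l.NeBot] {v : ℕ → ℝ} {y : ℕ → 𝕜}
    {b : ι → ℕ → 𝕜} {α : ℕ → 𝕜} {C : ℝ≥0} (hcol : ∀ k, Tendsto (fun n => b n k) l (𝓝 (α k)))
    (hrow : ∀ n, rowNorm v (b n) ≤ C) (hy : y =o[atTop] v) :
    Tendsto (fun n => ∑' k, b n k * y k) l (𝓝 (∑' k, α k * y k)) := by
  have hα : rowNorm v α ≤ C := rowNorm_le_of_tendsto hcol hrow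
  have hsummable {c : ℕ → 𝕜} (hc : rowNorm v c ≤ C) : Summable fun k => c k * y k :=
    summable_mul_of_isBigO (hc.trans_lt ENNReal.coe_lt_top).ne hy.isBigO
  have hdiff : (fun n => ∑' k, (b n k - α k) * y k) =o[l] fun _ => (1 : ℝ) := by
    refine isLittleO_tsum_mul (C := C + C) (fun k => ?_) (fun n => ?_) hy
    · exact (isLittleO_one_iff ℝ).2 (tendsto_sub_nhds_zero_iff.2 (hcol k))
    · simpa using (rowNorm_sub_le v (b n) α).trans (add_le_add (hrow n) hα)
  rw [← tendsto_sub_nhds_zero_iff]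
  refine ((isLittleO_one_iff ℝ).1 hdiff).congr fun n => ?_
  simp only [sub_mul, (hsummable (hrow n)).tsum_sub (hsummable hα)]

/-! ### Uniform boundedness on echelon spaces -/

/-- The (Köthe) echelon space of order `0` given by the weights `v i`. The usual defining matrix
has the entries `1 / v i k`, so the smaller the weights, the smaller the space. -/
def echelonC0 {ι : Type*} (𝕜 : Type*) [RCLike 𝕜] (v : ι → ℕ → ℝ) : Set (ℕ → 𝕜) :=
  {y | ∀ i, y =o[atTop] v i}

/-- The weights `v i` decrease to zero as `i` grows, uniformly with respect to each `v j`. Thus the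
unit balls of the weights `v i` shrink to zero in the echelon space. -/
structure IsWeightSystem {ι : Type*} [Preorder ι] (v : ι → ℕ → ℝ) : Prop where
  ne_zero : ∀ i k, v i k ≠ 0
  tendstoUniformly_div : ∀ j, TendstoUniformly (fun i k => v i k / v j k) (fun _ => 0) atTop

/-- Each row of `b` has a finite norm for one of the weights `v i`, hence is a continuous
functional on the echelon space. -/
def HasFiniteRows {ι : Type*} (v : ι → ℕ → ℝ) (b : ℕ → ℕ → 𝕜) : Prop :=
  ∀ n, ∃ i, rowNorm (v i) (b n) ≠ ⊤

/-- The rows of `b` are `O(μ n)` in the norm of one of the weights `v i`, uniformly in `n`: the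
matrix `b` is bounded from a single weighted `c₀` to the `μ`-weighted bounded sequences. -/
def IsRowBigO {ι : Type*} (v : ι → ℕ → ℝ) (b : ℕ → ℕ → 𝕜) (μ : ℕ → ℝ) : Prop :=
  ∃ i, ∃ C : ℝ≥0, ∀ n, rowNorm (v i) (b n) ≤ C * ‖μ n‖ₑ

/-- The echelon space as a projective limit: a sequence `z.1` together with null sequences `z.2 i`
such that `z.1 = v i • z.2 i`. Its topology is the product topology. -/
def echelonGraph {ι : Type*} (𝕜 : Type*) [RCLike 𝕜] (v : ι → ℕ → ℝ) :
    Set ((ℕ → 𝕜) × (ι → C₀(ℕ, 𝕜))) :=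
  {z | ∀ i k, z.1 k = v i k • z.2 i k}

section Echelon

variable {ι : Type*} {v : ι → ℕ → ℝ}

theorem mem_echelonC0_of_finite_support {y : ℕ → 𝕜} (hy : y.support.Finite) :
    y ∈ echelonC0 𝕜 v := fun i => by
  refine (isLittleO_zero (v i) atTop).congr' ?_ .rfl
  filter_upwards [Nat.cofinite_eq_atTop ▸ hy.compl_mem_cofinite] with k hk
  exact (Function.notMem_support.1 hk).symm

theorem single_mem_echelonC0 (k : ℕ) (c : 𝕜) : Pi.single k c ∈ echelonC0 𝕜 v :=
  mem_echelonC0_of_finite_support ((Set.finite_singleton k).subset Pi.support_single_subset)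

theorem tsum_mul_single (b : ℕ → 𝕜) (k : ℕ) : ∑' j, b j * (Pi.single k 1 : ℕ → 𝕜) j = b k := by
  rw [tsum_eq_single k fun j hj => by simp [hj]]
  simp

theorem add_mem_echelonC0 {y z : ℕ → 𝕜} (hy : y ∈ echelonC0 𝕜 v) (hz : z ∈ echelonC0 𝕜 v) :
    y + z ∈ echelonC0 𝕜 v :=
  fun i => (hy i).add (hz i)

section IsWeightSystem

variable [Preorder ι] [IsDirectedOrder ι] [Nonempty ι]

theorem IsWeightSystem.exists_forall_norm_le (hv : IsWeightSystem v) (j : ι) {ε : ℝ} (hε : 0 < ε) :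
    ∃ i, ∀ k, ‖v i k‖ ≤ ε * ‖v j k‖ := by
  obtain ⟨i, hi⟩ := (Metric.tendstoUniformly_iff.1 (hv.tendstoUniformly_div j) ε hε).exists
  refine ⟨i, fun k => ?_⟩
  rw [← div_le_iff₀ (norm_pos_iff.2 (hv.ne_zero j k)), ← norm_div, ← dist_zero_left]
  exact (hi k).le

theorem IsWeightSystem.exists_forall_mul_inv_enorm_le (hv : IsWeightSystem v) (j : ι) (C : ℝ≥0) :
    ∃ i, ∀ k, C * ‖v j k‖ₑ⁻¹ ≤ ‖v i k‖ₑ⁻¹ := by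
  obtain ⟨i, hi⟩ := hv.exists_forall_norm_le j (ε := (C + 1 : ℝ≥0)⁻¹) (by positivity)
  refine ⟨i, fun k => ?_⟩
  have hk : (C + 1) * ‖v i k‖₊ ≤ ‖v j k‖₊ := (le_inv_mul_iff₀ (by positivity)).1 (hi k)
  rw [ENNReal.le_inv_iff_mul_le, mul_right_comm, ← div_eq_mul_inv]
  refine ENNReal.div_le_of_le_mul ?_
  rw [one_mul, enorm_eq_nnnorm, enorm_eq_nnnorm, ← ENNReal.coe_mul, ENNReal.coe_le_coe]
  exact (mul_le_mul_left le_self_add _).trans hk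

theorem mem_echelonC0_iff (hv : IsWeightSystem v) {y : ℕ → 𝕜} :
    y ∈ echelonC0 𝕜 v ↔ ∀ i, ∀ᶠ k in atTop, ‖y k‖ ≤ ‖v i k‖ := by
  refine ⟨fun hy i => by simpa using (hy i).bound one_pos, fun h j =>
    isLittleO_iff.2 fun ε hε => ?_⟩
  obtain ⟨i, hi⟩ := hv.exists_forall_norm_le j hε
  exact (h i).mono fun k hk => hk.trans (hi k)

end IsWeightSystem

theorem HasFiniteRows.summable_mul {b : ℕ → ℕ → 𝕜} (hb : HasFiniteRows v b) (n : ℕ) {y : ℕ → 𝕜}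
    (hy : y ∈ echelonC0 𝕜 v) : Summable fun k => b n k * y k :=
  let ⟨i, hi⟩ := hb n
  summable_mul_of_isBigO hi (hy i).isBigO

theorem enorm_zeroAtInfty_apply_le (f : C₀(ℕ, 𝕜)) (k : ℕ) : ‖f k‖ₑ ≤ ‖f‖ₑ := by
  rw [enorm_le_iff_norm_le, ← ZeroAtInftyContinuousMap.norm_toBCF_eq_norm]
  exact f.toBCF.norm_coe_le_norm k

theorem continuous_zeroAtInfty_apply (k : ℕ) : Continuous fun f : C₀(ℕ, 𝕜) => f k :=
  (continuous_eval_const (F := BoundedContinuousFunction ℕ 𝕜) k).comp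
    ZeroAtInftyContinuousMap.isometry_toBCF.continuous

theorem tendsto_zeroAtInfty (f : C₀(ℕ, 𝕜)) : Tendsto f atTop (𝓝 0) := by
  simpa only [cocompact_eq_cofinite, Nat.cofinite_eq_atTop] using
    zero_at_infty f

theorem smul_zeroAtInfty_isLittleO (w : ℕ → ℝ) (f : C₀(ℕ, 𝕜)) :
    (fun k => w k • f k) =o[atTop] w := by
  simpa using (isBigO_refl w atTop).smul_isLittleO
    ((isLittleO_one_iff ℝ).2 (tendsto_zeroAtInfty f))

theorem continuous_tsum_mul_smul {w : ℕ → ℝ} {b : ℕ → 𝕜} (hb : rowNorm w b ≠ ⊤) :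
    Continuous fun f : C₀(ℕ, 𝕜) => ∑' k, b k * (w k • f k) := by
  have hsummable (f : C₀(ℕ, 𝕜)) : Summable fun k => b k * (w k • f k) :=
    summable_mul_of_isBigO hb (smul_zeroAtInfty_isLittleO w f).isBigO
  refine LipschitzWith.continuous (K := (rowNorm w b).toNNReal) fun f g => ?_
  rw [ENNReal.coe_toNNReal hb, edist_eq_enorm_sub, edist_eq_enorm_sub,
    ← (hsummable f).tsum_sub (hsummable g), mul_comm]
  simp_rw [← mul_sub, ← smul_sub]
  refine enorm_tsum_mul_le fun k => ?_
  rw [enorm_smul, mul_comm, ← ZeroAtInftyContinuousMap.sub_apply]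
  gcongr
  exact enorm_zeroAtInfty_apply_le (f - g) k

namespace echelonGraph

theorem isClosed : IsClosed (echelonGraph 𝕜 v) := by
  simp only [echelonGraph, Set.ofPred_forall]
  refine isClosed_iInter fun i => isClosed_iInter fun k => isClosed_eq
    ((continuous_apply k).comp continuous_fst) (Continuous.const_smul ?_ _)
  exact (continuous_zeroAtInfty_apply k).comp ((continuous_apply i).comp continuous_snd)

instance [Countable ι] : BaireSpace (echelonGraph 𝕜 v) :=
  have := (isClosed (𝕜 := 𝕜) (v := v)).isCompletelyMetrizableSpace
  inferInstance

theorem fst_mem_echelonC0 (z : echelonGraph 𝕜 v) : z.1.1 ∈ echelonC0 𝕜 v := fun i => by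
  rw [funext (z.2 i)]
  exact smul_zeroAtInfty_isLittleO (v i) (z.1.2 i)

/-- The point of the projective limit given by an element of the echelon space. -/
noncomputable def ofSeq (hv : ∀ i k, v i k ≠ 0) (y : ℕ → 𝕜) (hy : y ∈ echelonC0 𝕜 v) :
    echelonGraph 𝕜 v where
  val := (y, fun i =>
    { toFun := fun k => (v i k)⁻¹ • y k
      continuous_toFun := continuous_of_discreteTopology
      zero_at_infty' := by
        simpa only [cocompact_eq_cofinite, Nat.cofinite_eq_atTop] using
          (hy i).tendsto_inv_smul_nhds_zero })
  property := fun i k => (smul_inv_smul₀ (hv i k) (y k)).symm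

theorem ofSeq_fst (hv : ∀ i k, v i k ≠ 0) (z : echelonGraph 𝕜 v) :
    ofSeq hv z.1.1 (fst_mem_echelonC0 z) = z := by
  refine Subtype.ext (Prod.ext rfl (funext fun i => ZeroAtInftyContinuousMap.ext fun k => ?_))
  exact inv_smul_eq_iff₀ (hv i k) |>.2 (z.2 i k)

theorem continuous_tsum_mul {b : ℕ → 𝕜} {i : ι} (hb : rowNorm (v i) b ≠ ⊤) :
    Continuous fun z : echelonGraph 𝕜 v => ∑' k, b k * z.1.1 k := by
  have h := (continuous_tsum_mul_smul hb).comp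
    ((continuous_apply i).comp (continuous_snd.comp continuous_subtype_val) :
      Continuous fun z : echelonGraph 𝕜 v => z.1.2 i)
  refine h.congr fun z => tsum_congr fun k => ?_
  simp only [Function.comp_apply, z.2 i k]

theorem tendsto_ofSeq_add [Preorder ι] [Nonempty ι] (hv : IsWeightSystem v) {y : ℕ → 𝕜}
    {u : ι → ℕ → 𝕜} (hy : y ∈ echelonC0 𝕜 v) (hyu : ∀ i, y + u i ∈ echelonC0 𝕜 v)
    (hu : ∀ i k, ‖u i k‖ ≤ ‖v i k‖) :
    Tendsto (fun i => ofSeq hv.ne_zero (y + u i) (hyu i)) atTop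
      (𝓝 (ofSeq hv.ne_zero y hy)) := by
  have hsmall (j : ι) (ε : ℝ) (hε : 0 < ε) : ∀ᶠ i in atTop, ∀ k, ‖(v j k)⁻¹ • u i k‖ < ε := by
    filter_upwards [Metric.tendstoUniformly_iff.1 (hv.tendstoUniformly_div j) ε hε] with i hi k
    refine lt_of_le_of_lt ?_ (dist_zero_left (v i k / v j k) ▸ hi k)
    rw [norm_smul, norm_inv, norm_div, div_eq_inv_mul]
    gcongr
    exact hu i k
  refine tendsto_subtype_rng.2 (Tendsto.prodMk_nhds (tendsto_pi_nhds.2 fun k => ?_)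
    (tendsto_pi_nhds.2 fun j => ZeroAtInftyContinuousMap.tendsto_iff_tendstoUniformly.2 <|
      Metric.tendstoUniformly_iff.2 fun ε hε => ?_))
  · obtain ⟨j⟩ := ‹Nonempty ι›
    have hscaled : Tendsto (fun i => (v j k)⁻¹ • u i k) atTop (𝓝 0) :=
      Metric.tendsto_nhds.2 fun ε hε => (hsmall j ε hε).mono fun i hi => by simpa using hi k
    have hu₀ : Tendsto (fun i => u i k) atTop (𝓝 0) := by
      simpa [smul_inv_smul₀ (hv.ne_zero j k)] using hscaled.const_smul (v j k)
    simpa using hu₀.const_add (y k)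
  · filter_upwards [hsmall j ε hε] with i hi k
    simpa [dist_eq_norm, ofSeq] using hi k

theorem exists_forall_ofSeq_add_mem [Preorder ι] [IsDirectedOrder ι] [Nonempty ι]
    (hv : IsWeightSystem v) {y : ℕ → 𝕜} (hy : y ∈ echelonC0 𝕜 v) {S : Set (echelonGraph 𝕜 v)}
    (hS : S ∈ 𝓝 (ofSeq hv.ne_zero y hy)) :
    ∃ i, ∀ u : ℕ → 𝕜, u.support.Finite → (∀ k, ‖u k‖ ≤ ‖v i k‖) →
      ∃ hyu : y + u ∈ echelonC0 𝕜 v, ofSeq hv.ne_zero (y + u) hyu ∈ S := by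
  by_contra! h
  choose u hfin hle hnot using h
  have hyu (i : ι) := add_mem_echelonC0 hy (mem_echelonC0_of_finite_support (hfin i))
  obtain ⟨i, hi⟩ := ((tendsto_ofSeq_add hv hy hyu hle).eventually hS).exists
  exact hnot i (hyu i) hi

end echelonGraph

variable [Countable ι] [Preorder ι] [IsDirectedOrder ι] [Nonempty ι]

theorem exists_forall_rowNorm_le (hv : IsWeightSystem v) {b : ℕ → ℕ → 𝕜}
    (hb : HasFiniteRows v b) {κ : Type*} [Countable κ] (c : κ → ℕ → ℝ≥0∞)
    (h : ∀ y ∈ echelonC0 𝕜 v, ∃ L, ∀ n, ‖∑' k, b n k * y k‖ₑ ≤ c L n) :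
    ∃ L i, ∀ n, rowNorm (v i) (b n) ≤ 2 * c L n := by
  have hcont (n : ℕ) : Continuous fun z : echelonGraph 𝕜 v => ∑' k, b n k * z.1.1 k :=
    let ⟨_, hi⟩ := hb n
    echelonGraph.continuous_tsum_mul hi
  let F (L : κ) : Set (echelonGraph 𝕜 v) := {z | ∀ n, ‖∑' k, b n k * z.1.1 k‖ₑ ≤ c L n}
  have hF (L : κ) : IsClosed (F L) := by
    simp only [F, Set.ofPred_forall]
    exact isClosed_iInter fun n => isClosed_le (hcont n).enorm continuous_const
  have hcover : ⋃ L, F L = Set.univ := Set.eq_univ_of_forall fun z =>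
    Set.mem_iUnion.2 (h _ (echelonGraph.fst_mem_echelonC0 z))
  have : Nonempty (echelonGraph 𝕜 v) := ⟨echelonGraph.ofSeq hv.ne_zero 0
    (mem_echelonC0_of_finite_support (by simp))⟩
  obtain ⟨L, z, hz⟩ := nonempty_interior_of_iUnion_of_closed hF hcover
  have hzF : z ∈ F L := interior_subset hz
  have hzmem := echelonGraph.fst_mem_echelonC0 z
  rw [← echelonGraph.ofSeq_fst hv.ne_zero z, mem_interior_iff_mem_nhds] at hz
  obtain ⟨i, hi⟩ := echelonGraph.exists_forall_ofSeq_add_mem hv hzmem hz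
  refine ⟨L, i, fun n => rowNorm_le_of_forall_enorm_tsum_le fun u hfin hle => ?_⟩
  obtain ⟨hzu, hzuF⟩ := hi u hfin hle
  have hdiff : ∑' k, b n k * u k = ∑' k, b n k * (z.1.1 + u) k - ∑' k, b n k * z.1.1 k := by
    rw [← (hb.summable_mul n hzu).tsum_sub (hb.summable_mul n hzmem)]
    simp only [Pi.add_apply, ← mul_sub, add_sub_cancel_left]
  rw [hdiff, two_mul]
  exact enorm_sub_le.trans (add_le_add (hzuF n) (hzF n))

theorem isRowBigO_of_forall_isBigO (hv : IsWeightSystem v) {b : ℕ → ℕ → 𝕜}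
    (hb : HasFiniteRows v b) {μ : ℕ → ℝ} (hμ : ∀ n, μ n ≠ 0)
    (h : ∀ y ∈ echelonC0 𝕜 v, (fun n => ∑' k, b n k * y k) =O[atTop] μ) : IsRowBigO v b μ := by
  obtain ⟨M, i, hM⟩ := exists_forall_rowNorm_le hv hb (fun (M : ℕ) n => M * ‖μ n‖ₑ) fun y hy =>
    exists_forall_enorm_le_of_isBigO hμ (h y hy)
  exact ⟨i, 2 * M, fun n => by simpa [mul_assoc] using hM n⟩

end Echelon

/-! ### Matrix maps between echelon spaces -/

section MatrixMaps

variable {ι κ : Type*} {v : ι → ℕ → ℝ} {b : ℕ → ℕ → 𝕜} {α : ℕ → 𝕜}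

theorem IsRowBigO.hasFiniteRows {μ : ℕ → ℝ} (h : IsRowBigO v b μ) : HasFiniteRows v b := fun n =>
  let ⟨i, _, hC⟩ := h
  ⟨i, ((hC n).trans_lt (ENNReal.mul_lt_top ENNReal.coe_lt_top enorm_lt_top)).ne⟩

theorem IsRowBigO.isBigO_apply (hv : ∀ i k, v i k ≠ 0) {μ : ℕ → ℝ} (h : IsRowBigO v b μ) (k : ℕ) :
    (fun n => b n k) =O[atTop] μ := by
  obtain ⟨i, C, hC⟩ := h
  refine .of_bound (C / ‖v i k‖) (.of_forall fun n => ?_)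
  have hk : ‖b n k‖ₑ * ‖v i k‖ₑ ≤ C * ‖μ n‖ₑ := (ENNReal.le_tsum k).trans (hC n)
  simp only [enorm_eq_nnnorm, ← ENNReal.coe_mul, ENNReal.coe_le_coe] at hk
  rw [div_mul_eq_mul_div, le_div_iff₀ (norm_pos_iff.2 (hv i k))]
  exact hk

theorem IsRowBigO.trans_isBigO {μ ν : ℕ → ℝ} (h : IsRowBigO v b μ) (hν : ∀ n, ν n ≠ 0)
    (hμν : μ =O[atTop] ν) : IsRowBigO v b ν := by
  obtain ⟨i, C, hC⟩ := h
  obtain ⟨M, hM⟩ := exists_forall_enorm_le_of_isBigO hν hμν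
  refine ⟨i, C * M, fun n => (hC n).trans ?_⟩
  rw [ENNReal.coe_mul, mul_assoc, ENNReal.coe_natCast]
  gcongr
  exact hM n

theorem IsRowBigO.sub_of_tendsto (h : IsRowBigO v b 1)
    (hα : ∀ k, Tendsto (fun n => b n k) atTop (𝓝 (α k))) :
    IsRowBigO v (fun n k => b n k - α k) 1 := by
  obtain ⟨i, C, hC⟩ := h
  refine ⟨i, C + C, fun n => (rowNorm_sub_le (v i) (b n) α).trans ?_⟩
  rw [ENNReal.coe_add, add_mul]
  exact add_le_add (hC n) (rowNorm_le_of_tendsto hα fun n => by simpa using hC n)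

theorem tendsto_zero_of_mem_echelonC0 {μ : κ → ℕ → ℝ} {j : κ} (hμ : μ j =O[atTop] (1 : ℕ → ℝ))
    {x : ℕ → 𝕜} (hx : x ∈ echelonC0 𝕜 μ) : Tendsto x atTop (𝓝 0) :=
  (isLittleO_one_iff ℝ).1 ((hx j).trans_isBigO hμ)

theorem isRowBigO_sub_of_forall_isRowBigO_sub (hv : ∀ i k, v i k ≠ 0) {μ : κ → ℕ → ℝ}
    (hμ : ∀ j n, μ j n ≠ 0) (hcol : ∀ k, (fun n => b n k - α k) ∈ echelonC0 𝕜 μ)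
    (hbdd : IsRowBigO v (fun n k => b n k - α k) 1) {α' : ℕ → 𝕜}
    (hrow : ∀ j, IsRowBigO v (fun n k => b n k - α' k) (μ j)) (j : κ) :
    IsRowBigO v (fun n k => b n k - α k) (μ j) := by
  obtain rfl | hne := eq_or_ne α' α
  · exact hrow j
  obtain ⟨k, hk⟩ := Function.ne_iff.1 hne
  have hdiff : (fun _ : ℕ => α' k - α k) =O[atTop] μ j := by
    simpa using (hcol k j).isBigO.sub ((hrow j).isBigO_apply hv k)
  exact hbdd.trans_isBigO (hμ j)
    ((isBigO_const_const (1 : ℝ) (sub_ne_zero.2 hk) atTop).trans hdiff)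

theorem forall_exists_tsum_mul_sub_mem_echelonC0_iff {μ : κ → ℕ → ℝ} {j : κ}
    (hμ : μ j =O[atTop] (1 : ℕ → ℝ)) (hα : ∀ k, Tendsto (fun n => b n k) atTop (𝓝 (α k)))
    (hb : IsRowBigO v b 1) :
    (∀ y ∈ echelonC0 𝕜 v, ∃ l, (fun n => ∑' k, b n k * y k - l) ∈ echelonC0 𝕜 μ) ↔
      ∀ y ∈ echelonC0 𝕜 v, (fun n => ∑' k, (b n k - α k) * y k) ∈ echelonC0 𝕜 μ := by
  refine forall₂_congr fun y hy => ?_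
  obtain ⟨i, C, hC⟩ := id hb
  have hlim : Tendsto (fun n => ∑' k, b n k * y k) atTop (𝓝 (∑' k, α k * y k)) :=
    tendsto_tsum_mul hα (fun n => by simpa using hC n) (hy i)
  have hsub (n : ℕ) : ∑' k, (b n k - α k) * y k = ∑' k, b n k * y k - ∑' k, α k * y k := by
    rw [eq_sub_iff_add_eq', ← eq_sub_iff_add_eq, ← (hb.hasFiniteRows.summable_mul n hy).tsum_sub
      ((hb.sub_of_tendsto hα).hasFiniteRows.summable_mul n hy)]
    simp only [← sub_mul, sub_sub_cancel]
  simp_rw [hsub]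
  refine ⟨fun ⟨l, hl⟩ => ?_, fun h => ⟨_, h⟩⟩
  have hl' := tendsto_sub_nhds_zero_iff.1 (tendsto_zero_of_mem_echelonC0 hμ hl)
  rwa [tendsto_nhds_unique hlim hl']

variable [Countable ι] [Preorder ι] [IsDirectedOrder ι] [Nonempty ι]

theorem forall_tsum_mul_mem_echelonC0_iff (hv : IsWeightSystem v) (hb : HasFiniteRows v b)
    {μ : κ → ℕ → ℝ} (hμ : ∀ j n, μ j n ≠ 0) :
    (∀ y ∈ echelonC0 𝕜 v, (fun n => ∑' k, b n k * y k) ∈ echelonC0 𝕜 μ) ↔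
      (∀ k, (fun n => b n k) ∈ echelonC0 𝕜 μ) ∧ ∀ j, IsRowBigO v b (μ j) := by
  refine ⟨fun h => ⟨fun k => ?_, fun j => ?_⟩, fun ⟨hcol, hrow⟩ y hy j =>
    let ⟨i, _, hC⟩ := hrow j
    isLittleO_tsum_mul (fun k => hcol k j) hC (hy i)⟩
  · simpa only [tsum_mul_single] using h _ (single_mem_echelonC0 k 1)
  · exact isRowBigO_of_forall_isBigO hv hb (hμ j) fun y hy => (h y hy j).isBigO

theorem forall_exists_sub_mem_echelonC0_iff (hv : IsWeightSystem v) (hb : HasFiniteRows v b)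
    {μ : κ → ℕ → ℝ} (hμ : ∀ j n, μ j n ≠ 0) {j₀ : κ} (hμ₁ : μ j₀ =O[atTop] (1 : ℕ → ℝ)) :
    (∀ y ∈ echelonC0 𝕜 v, ∃ l, (fun n => ∑' k, b n k * y k - l) ∈ echelonC0 𝕜 μ) ↔
      (∃ α : ℕ → 𝕜, ∀ k, (fun n => b n k - α k) ∈ echelonC0 𝕜 μ) ∧ IsRowBigO v b 1 ∧
        ∃ α : ℕ → 𝕜, ∀ j, IsRowBigO v (fun n k => b n k - α k) (μ j) := by
  have hlim {x : ℕ → 𝕜} {l : 𝕜} (h : (fun n => x n - l) ∈ echelonC0 𝕜 μ) :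
      Tendsto x atTop (𝓝 l) := tendsto_sub_nhds_zero_iff.1 (tendsto_zero_of_mem_echelonC0 hμ₁ h)
  constructor
  · intro h
    have hbdd : IsRowBigO v b 1 := isRowBigO_of_forall_isBigO hv hb (by simp) fun y hy =>
      let ⟨_, hl⟩ := h y hy
      (hlim hl).isBigO_one ℝ
    choose α hα using fun k => h _ (single_mem_echelonC0 k 1)
    simp only [tsum_mul_single] at hα
    have htend (k : ℕ) := hlim (hα k)
    refine ⟨⟨α, hα⟩, hbdd, α, ?_⟩
    exact ((forall_tsum_mul_mem_echelonC0_iff hv (hbdd.sub_of_tendsto htend).hasFiniteRows hμ).1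
      ((forall_exists_tsum_mul_sub_mem_echelonC0_iff hμ₁ htend hbdd).1 h)).2
  · rintro ⟨⟨α, hα⟩, hbdd, α', hα'⟩
    have htend (k : ℕ) := hlim (hα k)
    have hsub := hbdd.sub_of_tendsto htend
    exact (forall_exists_tsum_mul_sub_mem_echelonC0_iff hμ₁ htend hbdd).2
      ((forall_tsum_mul_mem_echelonC0_iff hv hsub.hasFiniteRows hμ).2
        ⟨hα, isRowBigO_sub_of_forall_isRowBigO_sub hv.ne_zero hμ hα hsub hα'⟩)

theorem forall_exists_enorm_tsum_mul_le_iff (hv : IsWeightSystem v) (hb : HasFiniteRows v b)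
    [Countable κ] [Preorder κ] [IsDirectedOrder κ] [Nonempty κ] {μ : κ → ℕ → ℝ}
    (hμ : IsWeightSystem μ) :
    (∀ y ∈ echelonC0 𝕜 v, ∃ j, ∀ n, ‖∑' k, b n k * y k‖ₑ ≤ ‖μ j n‖ₑ⁻¹) ↔
      ∃ j i, ∀ n, rowNorm (v i) (b n) ≤ ‖μ j n‖ₑ⁻¹ := by
  constructor
  · intro h
    obtain ⟨j, i, hle⟩ := exists_forall_rowNorm_le hv hb (fun j n => ‖μ j n‖ₑ⁻¹) h
    obtain ⟨j', hj'⟩ := hμ.exists_forall_mul_inv_enorm_le j 2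
    exact ⟨j', i, fun n => (hle n).trans (hj' n)⟩
  · rintro ⟨j, i, hle⟩ y hy
    obtain ⟨M, hM⟩ := exists_forall_enorm_le_of_isBigO (hv.ne_zero i) (hy i).isBigO
    obtain ⟨j', hj'⟩ := hμ.exists_forall_mul_inv_enorm_le j M
    refine ⟨j', fun n => (enorm_tsum_mul_le hM).trans (le_trans ?_ (hj' n))⟩
    rw [ENNReal.coe_natCast]
    gcongr
    exact hle n

end MatrixMaps

/-! ### The `β`-dual of `X(r, s, t; Δ)` -/

section BetaDual

theorem mem_betaDual_of_mem_matrixClass {U V : Set (ℕ → 𝕜)} {A : ℕ → ℕ → 𝕜}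
    (hA : A ∈ matrixClass U V) (n : ℕ) : A n ∈ betaDual U := fun x hx =>
  let ⟨z, _, hz⟩ := hA x hx
  ⟨z n, hz n⟩

variable {r s t : ℕ → 𝕜}

theorem exists_tendsto_tsum_Emat_mul (hr : ∀ n, r n ≠ 0) (hs : s 0 ≠ 0) (ht : ∀ n, t n ≠ 0)
    {X : Set (ℕ → 𝕜)} {a : ℕ → 𝕜} (ha : a ∈ betaDual (meanDiffSpace r s t X)) {y : ℕ → 𝕜}
    (hy : y ∈ X) : ∃ l, Tendsto (fun m => ∑' k, Emat r s t a m k * y k) atTop (𝓝 l) := by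
  obtain ⟨x, rfl⟩ := exists_genMean_diff_eq hr hs ht y
  obtain ⟨l, hl⟩ := ha x hy
  exact ⟨l, (hl.comp (tendsto_add_atTop_nat 1)).congr
    (sum_range_mul_eq_tsum_Emat_mul hr hs ht a x)⟩

variable {ι : Type*} {v : ι → ℕ → ℝ} {A : ℕ → ℕ → 𝕜}

theorem tendsto_Emat_Etilde (hr : ∀ n, r n ≠ 0) (hs : s 0 ≠ 0) (ht : ∀ n, t n ≠ 0) {n : ℕ}
    (hA : A n ∈ betaDual (meanDiffSpace r s t (echelonC0 𝕜 v))) (k : ℕ) :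
    Tendsto (fun m => Emat r s t (A n) m k) atTop (𝓝 (Etilde r s t A n k)) := by
  obtain ⟨l, hl⟩ := exists_tendsto_tsum_Emat_mul hr hs ht hA (single_mem_echelonC0 k 1)
  simp only [tsum_mul_single] at hl
  exact tendsto_nhds_limUnder ⟨l, hl⟩

variable [Countable ι] [Preorder ι] [IsDirectedOrder ι] [Nonempty ι]

theorem exists_forall_rowNorm_Emat_le (hr : ∀ n, r n ≠ 0) (hs : s 0 ≠ 0) (ht : ∀ n, t n ≠ 0)
    (hv : IsWeightSystem v) {a : ℕ → 𝕜}
    (ha : a ∈ betaDual (meanDiffSpace r s t (echelonC0 𝕜 v))) :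
    ∃ i, ∃ C : ℝ≥0, ∀ m, rowNorm (v i) (Emat r s t a m) ≤ C := by
  have hfin : HasFiniteRows v (Emat r s t a) := fun _ =>
    ⟨Classical.arbitrary ι, rowNorm_ne_top_of_eq_zero fun _ => Emat_eq_zero⟩
  simpa [IsRowBigO] using isRowBigO_of_forall_isBigO hv hfin (μ := 1) (by simp) fun y hy =>
    let ⟨_, hl⟩ := exists_tendsto_tsum_Emat_mul hr hs ht ha hy
    hl.isBigO_one ℝ

theorem hasFiniteRows_Etilde (hr : ∀ n, r n ≠ 0) (hs : s 0 ≠ 0) (ht : ∀ n, t n ≠ 0)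
    (hv : IsWeightSystem v)
    (hA : ∀ n, A n ∈ betaDual (meanDiffSpace r s t (echelonC0 𝕜 v))) :
    HasFiniteRows v (Etilde r s t A) := fun n => by
  obtain ⟨i, C, hC⟩ := exists_forall_rowNorm_Emat_le hr hs ht hv (hA n)
  exact ⟨i, ((rowNorm_le_of_tendsto (tendsto_Emat_Etilde hr hs ht (hA n)) hC).trans_lt
    ENNReal.coe_lt_top).ne⟩

theorem isTransform_tsum_Etilde_mul (hr : ∀ n, r n ≠ 0) (hs : s 0 ≠ 0) (ht : ∀ n, t n ≠ 0)
    (hv : IsWeightSystem v)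
    (hA : ∀ n, A n ∈ betaDual (meanDiffSpace r s t (echelonC0 𝕜 v))) {x : ℕ → 𝕜}
    (hx : genMean r s t (diff x) ∈ echelonC0 𝕜 v) :
    IsTransform A x fun n => ∑' k, Etilde r s t A n k * genMean r s t (diff x) k := fun n => by
  obtain ⟨i, C, hC⟩ := exists_forall_rowNorm_Emat_le hr hs ht hv (hA n)
  rw [← tendsto_add_atTop_iff_nat 1]
  simp_rw [sum_range_mul_eq_tsum_Emat_mul hr hs ht]
  exact tendsto_tsum_mul (tendsto_Emat_Etilde hr hs ht (hA n)) hC (hx i)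

theorem mem_matrixClass_iff (hr : ∀ n, r n ≠ 0) (hs : s 0 ≠ 0) (ht : ∀ n, t n ≠ 0)
    (hv : IsWeightSystem v)
    (hA : ∀ n, A n ∈ betaDual (meanDiffSpace r s t (echelonC0 𝕜 v))) {V : Set (ℕ → 𝕜)} :
    A ∈ matrixClass (meanDiffSpace r s t (echelonC0 𝕜 v)) V ↔
      ∀ y ∈ echelonC0 𝕜 v, (fun n => ∑' k, Etilde r s t A n k * y k) ∈ V := by
  refine ⟨fun h y hy => ?_, fun h x hx =>
    ⟨_, h _ hx, isTransform_tsum_Etilde_mul hr hs ht hv hA hx⟩⟩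
  obtain ⟨x, rfl⟩ := exists_genMean_diff_eq hr hs ht y
  obtain ⟨z, hz, hzt⟩ := h x hy
  convert hz with n
  exact tendsto_nhds_unique (isTransform_tsum_Etilde_mul hr hs ht hv hA hy n) (hzt n)

theorem mem_matrixClass_iff_and_mem_betaDual (hr : ∀ n, r n ≠ 0) (hs : s 0 ≠ 0)
    (ht : ∀ n, t n ≠ 0) (hv : IsWeightSystem v) {V : Set (ℕ → 𝕜)} {P : Prop}
    (hP : HasFiniteRows v (Etilde r s t A) →
      ((∀ y ∈ echelonC0 𝕜 v, (fun n => ∑' k, Etilde r s t A n k * y k) ∈ V) ↔ P)) :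
    A ∈ matrixClass (meanDiffSpace r s t (echelonC0 𝕜 v)) V ↔
      P ∧ ∀ n, A n ∈ betaDual (meanDiffSpace r s t (echelonC0 𝕜 v)) := by
  have hiff (hA : ∀ n, A n ∈ betaDual (meanDiffSpace r s t (echelonC0 𝕜 v))) :=
    (mem_matrixClass_iff hr hs ht hv hA).trans (hP (hasFiniteRows_Etilde hr hs ht hv hA))
  exact ⟨fun h => have hA := mem_betaDual_of_mem_matrixClass h; ⟨(hiff hA).1 h, hA⟩,
    fun ⟨h, hA⟩ => (hiff hA).2 h⟩

end BetaDual

/-! ### Maddox's spaces -/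

section Maddox

theorem exists_pnat_ge (a : ℝ) : ∃ N : ℕ+, a ≤ N :=
  ⟨⌈a⌉₊.succPNat, (Nat.le_ceil a).trans (by simp)⟩

theorem exists_one_le_and_iff_exists_pnat {P : ℕ → Prop} :
    (∃ N, 1 ≤ N ∧ P N) ↔ ∃ N : ℕ+, P N :=
  ⟨fun ⟨N, hN, h⟩ => ⟨⟨N, hN⟩, h⟩, fun ⟨N, h⟩ => ⟨N, N.pos, h⟩⟩

theorem forall_one_le_imp_iff_forall_pnat {P : ℕ → Prop} :
    (∀ N, 1 ≤ N → P N) ↔ ∀ N : ℕ+, P N :=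
  ⟨fun h N => h N N.pos, fun h N hN => h ⟨N, hN⟩⟩

theorem iSup_lt_top_iff_exists_le {ι : Sort*} {f : ι → ℝ≥0∞} :
    ⨆ i, f i < ⊤ ↔ ∃ C : ℝ≥0, ∀ i, f i ≤ C := by
  simp only [← iSup_le_iff]
  exact ⟨fun h => ⟨_, (ENNReal.coe_toNNReal h.ne).ge⟩, fun ⟨C, hC⟩ =>
    hC.trans_lt ENNReal.coe_lt_top⟩

/-- The weights `N ^ (-1 / p k)` of Maddox's space `c₀(p)` as an echelon space. -/
noncomputable def maddoxWeight (p : ℕ → ℝ) (N : ℕ+) (k : ℕ) : ℝ :=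
  (N : ℝ) ^ (-(1 / p k))

variable {p q : ℕ → ℝ} {x : ℕ → 𝕜} {A : ℕ → ℕ → 𝕜}

theorem maddoxWeight_pos (p : ℕ → ℝ) (N : ℕ+) (k : ℕ) : 0 < maddoxWeight p N k :=
  Real.rpow_pos_of_pos (by exact_mod_cast N.pos) _

theorem enorm_maddoxWeight (p : ℕ → ℝ) (N : ℕ+) (k : ℕ) :
    ‖maddoxWeight p N k‖ₑ = (N : ℝ≥0∞) ^ (-(1 / p k)) := by
  rw [Real.enorm_eq_ofReal (maddoxWeight_pos p N k).le, maddoxWeight,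
    ← ENNReal.ofReal_rpow_of_pos (by exact_mod_cast N.pos), ENNReal.ofReal_natCast]

theorem inv_enorm_maddoxWeight (p : ℕ → ℝ) (N : ℕ+) (k : ℕ) :
    ‖maddoxWeight p N k‖ₑ⁻¹ = (N : ℝ≥0∞) ^ (1 / p k) := by
  rw [enorm_maddoxWeight, ENNReal.rpow_neg, inv_inv]

theorem maddoxWeight_one (p : ℕ → ℝ) : maddoxWeight p 1 = 1 := by
  ext k
  simp [maddoxWeight]

theorem isWeightSystem_maddoxWeight (hp : ∀ k, 0 < p k) (hpb : BddAbove (Set.range p)) :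
    IsWeightSystem (maddoxWeight p) where
  ne_zero N k := (maddoxWeight_pos p N k).ne'
  tendstoUniformly_div M := by
    obtain ⟨P, hP⟩ := hpb
    have hpP (k : ℕ) : p k ≤ P := hP ⟨k, rfl⟩
    have hP₀ : 0 < P := (hp 0).trans_le (hpP 0)
    have hlim : Tendsto (fun N : ℕ+ => ((M : ℝ) / N) ^ (1 / P)) atTop (𝓝 0) := by
      have hdiv : Tendsto (fun N : ℕ+ => (M : ℝ) / N) atTop (𝓝 0) :=
        (tendsto_const_div_atTop_nhds_zero_nat _).comp tendsto_PNat_val_atTop_atTop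
      simpa [hP₀.ne'] using hdiv.rpow_const (p := 1 / P) (.inr (by positivity))
    refine Metric.tendstoUniformly_iff.2 fun ε hε => ?_
    filter_upwards [hlim.eventually_lt_const hε, eventually_ge_atTop M] with N hNε hMN k
    have hM : (0 : ℝ) < M := by exact_mod_cast M.pos
    have hN : (0 : ℝ) < N := by exact_mod_cast N.pos
    rw [dist_zero_left, Real.norm_of_nonneg (div_nonneg (maddoxWeight_pos p N k).le
      (maddoxWeight_pos p M k).le)]
    refine lt_of_le_of_lt ?_ hNε
    calc maddoxWeight p N k / maddoxWeight p M k = ((M : ℝ) / N) ^ (1 / p k) := by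
          rw [maddoxWeight, maddoxWeight, ← Real.div_rpow hN.le hM.le,
            Real.rpow_neg (by positivity), ← Real.inv_rpow (by positivity), inv_div]
      _ ≤ ((M : ℝ) / N) ^ (1 / P) := by
        refine Real.rpow_le_rpow_of_exponent_ge (by positivity) ?_
          (one_div_le_one_div_of_le (hp k) (hpP k))
        exact (div_le_one hN).2 (by exact_mod_cast hMN)

theorem le_maddoxWeight_iff {N : ℕ+} {k : ℕ} (hp : 0 < p k) {a : ℝ} (ha : 0 ≤ a) :
    a ≤ maddoxWeight p N k ↔ a ^ p k ≤ 1 / (N : ℝ) := by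
  rw [maddoxWeight, Real.rpow_neg (by positivity), ← Real.inv_rpow (by positivity), one_div,
    one_div, Real.le_rpow_inv_iff_of_pos ha (by positivity) hp]

theorem maddoxC0_eq_echelonC0 (hp : ∀ k, 0 < p k) (hpb : BddAbove (Set.range p)) :
    maddoxC0 𝕜 p = echelonC0 𝕜 (maddoxWeight p) := by
  ext x
  rw [mem_echelonC0_iff (isWeightSystem_maddoxWeight hp hpb)]
  simp only [Real.norm_of_nonneg, (maddoxWeight_pos _ _ _).le,
    le_maddoxWeight_iff (hp _) (norm_nonneg _)]
  refine ⟨fun h N => ?_, fun h => ?_⟩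
  · exact (h.eventually_lt_const (by positivity)).mono fun k hk => hk.le
  · refine Metric.tendsto_nhds.2 fun ε hε => ?_
    obtain ⟨N, hN⟩ := exists_pnat_ge (2 / ε)
    filter_upwards [h N] with k hk
    rw [dist_zero_right, Real.norm_of_nonneg (by positivity)]
    calc ‖x k‖ ^ p k ≤ 1 / (N : ℝ) := hk
      _ ≤ 1 / (2 / ε) := one_div_le_one_div_of_le (by positivity) hN
      _ < ε := by
        rw [one_div_div]
        exact half_lt_self hε

theorem mem_maddoxC_iff (hq : ∀ n, 0 < q n) (hqb : BddAbove (Set.range q)) :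
    x ∈ maddoxC 𝕜 q ↔ ∃ l, (fun n => x n - l) ∈ echelonC0 𝕜 (maddoxWeight q) := by
  rw [← maddoxC0_eq_echelonC0 hq hqb]
  rfl

theorem condColNull_iff (hq : ∀ n, 0 < q n) (hqb : BddAbove (Set.range q)) :
    CondColNull q A ↔ ∀ k, (fun n => A n k) ∈ echelonC0 𝕜 (maddoxWeight q) := by
  rw [← maddoxC0_eq_echelonC0 hq hqb]
  rfl

theorem le_inv_enorm_maddoxWeight_iff {N : ℕ+} {k : ℕ} (hp : 0 < p k) {a : ℝ≥0∞} :
    a ≤ ‖maddoxWeight p N k‖ₑ⁻¹ ↔ a ^ p k ≤ N := by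
  rw [inv_enorm_maddoxWeight, one_div, ENNReal.le_rpow_inv_iff hp]

theorem mem_maddoxLinf_iff (hq : ∀ n, 0 < q n) :
    x ∈ maddoxLinf 𝕜 q ↔ ∃ L, ∀ n, ‖x n‖ₑ ≤ ‖maddoxWeight q L n‖ₑ⁻¹ := by
  have hnorm (L : ℕ+) (n : ℕ) : ‖x n‖ₑ ≤ ‖maddoxWeight q L n‖ₑ⁻¹ ↔ ‖x n‖ ^ q n ≤ L := by
    rw [le_inv_enorm_maddoxWeight_iff (hq n), ← ofReal_norm,
      ENNReal.ofReal_rpow_of_nonneg (norm_nonneg _) (hq n).le, ENNReal.ofReal_le_natCast]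
  simp only [hnorm]
  refine ⟨fun ⟨C, hC⟩ => ?_, fun ⟨L, hL⟩ => ⟨L, Set.forall_mem_range.2 hL⟩⟩
  obtain ⟨L, hL⟩ := exists_pnat_ge C
  exact ⟨L, fun n => (hC ⟨n, rfl⟩).trans hL⟩

theorem rowNorm_maddoxWeight (p : ℕ → ℝ) (N : ℕ+) (b : ℕ → 𝕜) :
    rowNorm (maddoxWeight p N) b = ∑' k, ‖b k‖ₑ * (N : ℝ≥0∞) ^ (-(1 / p k)) := by
  simp only [rowNorm, enorm_maddoxWeight]

theorem condRowNull_iff :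
    CondRowNull p q A ↔ ∀ L, IsRowBigO (maddoxWeight p) A (maddoxWeight q L) := by
  simp only [CondRowNull, forall_one_le_imp_iff_forall_pnat, exists_one_le_and_iff_exists_pnat,
    iSup_lt_top_iff_exists_le, ← rowNorm_maddoxWeight, ← inv_enorm_maddoxWeight]
  refine forall_congr' fun L => exists₂_congr fun N C => forall_congr' fun n => ?_
  rw [mul_comm, ← div_eq_mul_inv,
    ENNReal.div_le_iff (by simp [(maddoxWeight_pos q L n).ne']) (by simp)]

theorem condRowBdd_iff : CondRowBdd p A ↔ IsRowBigO (maddoxWeight p) A 1 := by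
  simp only [CondRowBdd, exists_one_le_and_iff_exists_pnat, iSup_lt_top_iff_exists_le,
    ← rowNorm_maddoxWeight, IsRowBigO, Pi.one_apply, enorm_one, mul_one]

theorem condRowPowBdd_iff (hq : ∀ n, 0 < q n) :
    CondRowPowBdd p q A ↔
      ∃ L N, ∀ n, rowNorm (maddoxWeight p N) (A n) ≤ ‖maddoxWeight q L n‖ₑ⁻¹ := by
  simp only [CondRowPowBdd, exists_one_le_and_iff_exists_pnat, iSup_lt_top_iff_exists_le,
    ← rowNorm_maddoxWeight, le_inv_enorm_maddoxWeight_iff (hq _)]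
  rw [exists_comm]
  refine ⟨fun ⟨C, N, hC⟩ => ?_, fun ⟨L, N, hL⟩ => ⟨L, N, by exact_mod_cast hL⟩⟩
  obtain ⟨L, hL⟩ := exists_pnat_ge C
  exact ⟨L, N, fun n => (hC n).trans (by exact_mod_cast hL)⟩

end Maddox

end GeneralizedMeans

theorem corollary4p1 {𝕜 : Type*} [RCLike 𝕜]
    (r s t : ℕ → 𝕜) (hr : ∀ n, r n ≠ 0) (hs : s 0 ≠ 0) (ht : ∀ n, t n ≠ 0)
    (p q : ℕ → ℝ) (hp : ∀ k, 0 < p k) (hpb : BddAbove (Set.range p))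
    (hq : ∀ k, 0 < q k) (hqb : BddAbove (Set.range q))
    (A : ℕ → ℕ → 𝕜) :
    (A ∈ matrixClass (meanDiffSpace r s t (maddoxC0 𝕜 p)) (maddoxC0 𝕜 q) ↔
      CondColNull q (Etilde r s t A) ∧ CondRowNull p q (Etilde r s t A) ∧
        ∀ n, A n ∈ betaDual (meanDiffSpace r s t (maddoxC0 𝕜 p))) ∧
    (A ∈ matrixClass (meanDiffSpace r s t (maddoxC0 𝕜 p)) (maddoxC 𝕜 q) ↔
      CondColConv q (Etilde r s t A) ∧ CondRowBdd p (Etilde r s t A) ∧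
        CondRowConv p q (Etilde r s t A) ∧
        ∀ n, A n ∈ betaDual (meanDiffSpace r s t (maddoxC0 𝕜 p))) ∧
    (A ∈ matrixClass (meanDiffSpace r s t (maddoxC0 𝕜 p)) (maddoxLinf 𝕜 q) ↔
      CondRowPowBdd p q (Etilde r s t A) ∧
        ∀ n, A n ∈ betaDual (meanDiffSpace r s t (maddoxC0 𝕜 p))) := by
  have hv := isWeightSystem_maddoxWeight hp hpb
  have hμ := isWeightSystem_maddoxWeight hq hqb
  rw [maddoxC0_eq_echelonC0 hp hpb, maddoxC0_eq_echelonC0 hq hqb]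
  refine ⟨?_, ?_, ?_⟩
  · rw [← and_assoc, condColNull_iff hq hqb, condRowNull_iff]
    exact mem_matrixClass_iff_and_mem_betaDual hr hs ht hv fun hA =>
      forall_tsum_mul_mem_echelonC0_iff hv hA hμ.ne_zero
  · simp only [CondColConv, condColNull_iff hq hqb, condRowBdd_iff, CondRowConv, condRowNull_iff]
    rw [← and_assoc, ← and_assoc, and_assoc (b := IsRowBigO _ _ _)]
    refine mem_matrixClass_iff_and_mem_betaDual hr hs ht hv fun hA => ?_
    simp only [mem_maddoxC_iff hq hqb]
    exact forall_exists_sub_mem_echelonC0_iff hv hA hμ.ne_zero (j₀ := 1)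
      (maddoxWeight_one q ▸ Asymptotics.isBigO_refl _ _)
  · rw [condRowPowBdd_iff hq]
    refine mem_matrixClass_iff_and_mem_betaDual hr hs ht hv fun hA => ?_
    simp only [mem_maddoxLinf_iff hq]
    exact forall_exists_enorm_tsum_mul_le_iff hv hA hμ
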